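/- Let $\lambda,c>0$ and $p,q\ge 0$ with $p+q<1$. A particle starts at the origin of the plane at time $0$ and moves with speed $c$ along the directions $d_j=(\cos\frac{\pi j}{2},\sin\frac{\pi j}{2})$, where $j$ is taken modulo $4$; its initial direction is uniformly distributed on $\{d_0,d_1,d_2,d_3\}$. At the events of a Poisson process of intensity $\lambda$, independent of the initial direction, the direction changes: independently of everything else, it passes from $d_j$ to $d_{j+1}$ with probability $p$, to $d_{j-1}$ with probability $q$, and to $d_{j+2}$ (reflection) with probability $1-p-q$. Let $(X(t),Y(t))$ be the position at time $t$, and let $I_0(z)=\sum_{k\ge 0}\frac{(z/2)^{2k}}{(k!)^2}$ be the modified Bessel function of order $0$. Then for every $t>0$ the function $$g(x,t)=\frac{e^{-\lambda t}}{4c}\left[\lambda(1-p-q)\,I_0\!\left(\tfrac{\lambda}{c}(1-p-q)\sqrt{c^2t^2-x^2}\right)+\frac{\partial}{\partial t}I_0\!\left(\tfrac{\lambda}{c}(1-p-q)\sqrt{c^2t^2-x^2}\right)\right],\qquad |x|<ct,$$ is well defined (the time derivative exists), nonnegative and continuous in $x$, and it is the density of $X(t)$ on the event $\{Y(t)=0\}$: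 for every Borel set $B\subseteq(-ct,ct)$, $$\mathbb{P}\big(X(t)\in B,\;Y(t)=0\big)=\int_B g(x,t)\,dx.$$ -/

import Mathlib

open MeasureTheory ProbabilityTheory Set

noncomputable section

/-- The modified Bessel function of the first kind of order zero,
`I₀(z) = ∑ₖ (z/2)^(2k) / (k!)²`. -/
def besselI0 (z : ℝ) : ℝ :=
  ∑' k : ℕ, (z / 2) ^ (2 * k) / ((Nat.factorial k : ℝ)) ^ 2

namespace PlanarMotion

/-- The driving randomness of the planar motion. The four directions are indexed by integers
modulo `4`, via `d_j = (cos (π j / 2), sin (π j / 2))`.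
* `J₀` is the index of the initial direction, uniform on `{0, 1, 2, 3}`;
* `τ 0, τ 1, …` are the interarrival times of the changes of direction: they are i.i.d.
  exponential of rate `lam`, so that the changes form a Poisson process of intensity `lam`;
* `ξ 0, ξ 1, …` are the successive turns, i.i.d.: `+1` (counter-clockwise) with probability `p`,
  `-1` (clockwise) with probability `q`, `+2` (reflection) with probability `1 - p - q`;
* the initial direction, the interarrival times and the turns are independent. -/
structure IsDriving {Ω : Type*} [MeasurableSpace Ω] (P : Measure Ω) (lam p q : ℝ)
    (J₀ : Ω → ℤ) (τ : ℕ → Ω → ℝ) (ξ : ℕ → Ω → ℤ) : Prop where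
  measurable_init : Measurable J₀
  measurable_time : ∀ n, Measurable (τ n)
  measurable_turn : ∀ n, Measurable (ξ n)
  law_init : ∀ j : ℤ, 0 ≤ j → j ≤ 3 → P {ω | J₀ ω = j} = 1 / 4
  law_time : ∀ n, P.map (τ n) = expMeasure lam
  law_counterclockwise : ∀ n, P {ω | ξ n ω = 1} = ENNReal.ofReal p
  law_clockwise : ∀ n, P {ω | ξ n ω = -1} = ENNReal.ofReal q
  law_reflection : ∀ n, P {ω | ξ n ω = 2} = ENNReal.ofReal (1 - p - q)
  indep_time : iIndepFun τ P
  indep_turn : iIndepFun ξ P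
  indep_time_turn : IndepFun (fun ω n => τ n ω) (fun ω n => ξ n ω) P
  indep_init : IndepFun J₀ (fun ω => ((fun n => τ n ω), (fun n => ξ n ω))) P

variable {Ω : Type*}

/-- The time of the `n`-th change of direction (`n ≥ 1`), and `0` for `n = 0`. -/
def arrival (τ : ℕ → Ω → ℝ) (n : ℕ) (ω : Ω) : ℝ :=
  ∑ k ∈ Finset.range n, τ k ω

/-- `N(t)`: the number of changes of direction up to time `t` (almost surely finite; the junk
value `0` is used on the null event that there are infinitely many). -/
def count (τ : ℕ → Ω → ℝ) (t : ℝ) (ω : Ω) : ℕ :=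
  Set.ncard {n : ℕ | 1 ≤ n ∧ arrival τ n ω ≤ t}

/-- The index of the direction `D(t)`: the initial one, shifted by the first `N(t)` turns. -/
def dirIndex (J₀ : Ω → ℤ) (τ : ℕ → Ω → ℝ) (ξ : ℕ → Ω → ℤ) (t : ℝ) (ω : Ω) : ℤ :=
  J₀ ω + ∑ k ∈ Finset.range (count τ t ω), ξ k ω

/-- The abscissa `X(t)` of the particle, which starts at the origin and moves with speed `c`. -/
def posX (c : ℝ) (J₀ : Ω → ℤ) (τ : ℕ → Ω → ℝ) (ξ : ℕ → Ω → ℤ) (t : ℝ) (ω : Ω) : ℝ :=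
  ∫ s in (0 : ℝ)..t, c * Real.cos (Real.pi / 2 * (dirIndex J₀ τ ξ s ω : ℝ))

/-- The ordinate `Y(t)` of the particle. -/
def posY (c : ℝ) (J₀ : Ω → ℤ) (τ : ℕ → Ω → ℝ) (ξ : ℕ → Ω → ℤ) (t : ℝ) (ω : Ω) : ℝ :=
  ∫ s in (0 : ℝ)..t, c * Real.sin (Real.pi / 2 * (dirIndex J₀ τ ξ s ω : ℝ))

/-- `I₀((λ/c)(1-p-q)√(c²t²-x²))`. -/
def besselTerm (lam c p q x t : ℝ) : ℝ :=
  besselI0 (lam / c * (1 - p - q) * Real.sqrt (c ^ 2 * t ^ 2 - x ^ 2))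

/-- `g(x,t) = e^{-λt}/(4c) [λ(1-p-q) I₀(…) + ∂ₜ I₀(…)]`. -/
def diagDensity (lam c p q x t : ℝ) : ℝ :=
  Real.exp (-lam * t) / (4 * c) *
    (lam * (1 - p - q) * besselTerm lam c p q x t
      + deriv (fun s => besselTerm lam c p q x s) t)

end PlanarMotion

end

/-! Up to time `t` the ordinate is `c` times an integer combination of the flight lengths, each
flight contributing with coefficient 0 if horizontal and 1 or -1 if vertical. The flight times are
independent with diffuse laws, so almost surely no nontrivial integer combination of finitely many
of them equals an integer multiple of `t`. Hence, up to a null event, `Y(t) = 0` only when every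
flight is horizontal: the particle starts along `d_0` or `d_2` and every turn before `t` is a
reflection (`IsDriving.ae_ne_of_ne_zero`, `posY_eq_zero_iff`, `IsDriving.ae_mem_iff`).

On that event the motion is one-dimensional and alternating. With `n` turns, `X(t) = ± c (t - 2 W)`,
where `W` is the time spent in flights of parity opposite to the last one. Here `W` is a sum of `(n
+ 1) / 2` exponential times, hence Erlang for `n ≥ 1`; given `W = w`, the other `n / 2` complete
flights must be exactly the renewals of a Poisson process in an interval of length `t - w`.
Multiplying the Erlang density by the Poisson weight gives `flightDensity`
(`measure_sum_mem_and_le_lt_add`). The turns contribute the factor `(1 - p - q) ^ n`, each initial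
direction `1 / 4`, and the change of variable from `w` to `x` contributes `1 / (2 c)`.

It remains to sum over `n ≥ 1`, since `n = 0` puts the particle at `± c t`, outside the open
interval. Odd `n` produce the series of `I₀`, even `n` that of its time derivative
(`hasSum_diagDensity`). -/

noncomputable section

/-! ### Power series with factorially small coefficients -/

section PowerSeries

/-- A power series whose coefficients are dominated by `1 / k!` can be differentiated termwise. -/
theorem hasDerivAt_tsum_mul_pow_of_le_inv_factorial {a : ℕ → ℝ}
    (ha : ∀ k, |a k| ≤ 1 / (k.factorial : ℝ)) (y : ℝ) :
    HasDerivAt (fun z => ∑' k, a k * z ^ k) (∑' k : ℕ, ((k : ℝ) + 1) * a (k + 1) * y ^ k) y := by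
  -- Any radius beyond `|y|` works: on the ball the differentiated terms are dominated by `R ^ (k -
  -- 1) / (k - 1)!`.
  set R : ℝ := |y| + 1 with hR
  have hRpos : 0 < R := by positivity
  have hu : Summable (fun k : ℕ => (1 / (k.factorial : ℝ)) * ((k : ℝ) * R ^ (k - 1))) := by
    rw [← summable_nat_add_iff 1]
    refine (Real.summable_pow_div_factorial R).congr fun k => ?_
    have : (k.factorial : ℝ) ≠ 0 := by positivity
    rw [Nat.factorial_succ]
    push_cast
    field_simp
  have hder := hasDerivAt_tsum_of_isPreconnected (𝕜 := ℝ) (F := ℝ)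
    (g := fun k z => a k * z ^ k) (g' := fun k z => a k * ((k : ℝ) * z ^ (k - 1)))
    (t := Metric.ball 0 R) (y₀ := 0) (y := y) hu Metric.isOpen_ball
    (convex_ball 0 R).isPreconnected
    (fun k z _ => (hasDerivAt_pow k z).const_mul (a k))
    (fun k z hz => by
      rw [mem_ball_zero_iff, Real.norm_eq_abs] at hz
      rw [Real.norm_eq_abs, abs_mul, abs_mul, abs_pow, Nat.abs_cast]
      gcongr
      exact ha k)
    (Metric.mem_ball_self hRpos)
    (summable_of_ne_finset_zero (s := {0}) fun k hk => by
      have : k ≠ 0 := by simpa using hk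
      simp [this])
    (by rw [mem_ball_zero_iff, Real.norm_eq_abs, hR]; linarith)
  have hs : Summable (fun k : ℕ => a k * ((k : ℝ) * y ^ (k - 1))) := by
    refine Summable.of_norm_bounded hu fun k => ?_
    rw [Real.norm_eq_abs, abs_mul, abs_mul, abs_pow, Nat.abs_cast]
    gcongr
    · exact ha k
    · rw [hR]; linarith
  have heq : ∑' k : ℕ, ((k : ℝ) + 1) * a (k + 1) * y ^ k =
      ∑' k : ℕ, a k * ((k : ℝ) * y ^ (k - 1)) := by
    rw [hs.tsum_eq_zero_add]
    simp only [Nat.cast_zero, zero_mul, mul_zero, zero_add, Nat.add_sub_cancel]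
    refine tsum_congr fun k => ?_
    push_cast
    ring
  rw [heq]
  exact hder

theorem summable_mul_pow_of_le_inv_factorial {a : ℕ → ℝ}
    (ha : ∀ k, |a k| ≤ 1 / (k.factorial : ℝ)) (y : ℝ) : Summable (fun k => a k * y ^ k) := by
  refine Summable.of_norm_bounded (Real.summable_pow_div_factorial |y|) fun k => ?_
  rw [Real.norm_eq_abs, abs_mul, abs_pow, div_eq_mul_one_div, mul_comm]
  gcongr
  exact ha k

end PowerSeries

/-! ### The Bessel function as an entire function of its squared argument -/

/-- The entire function `∑ₖ y ^ k / (k!)²`, equal to `I₀ (2 √y)` for `y ≥ 0`. -/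
def besselSeries (y : ℝ) : ℝ := ∑' k : ℕ, 1 / (k.factorial : ℝ) ^ 2 * y ^ k

/-- The derivative `∑ₖ y ^ k / (k! (k + 1)!)` of `besselSeries`. -/
def besselSeriesDeriv (y : ℝ) : ℝ :=
  ∑' k : ℕ, 1 / ((k.factorial : ℝ) * ((k + 1).factorial : ℝ)) * y ^ k

theorem abs_besselSeries_coeff_le (k : ℕ) :
    |1 / (k.factorial : ℝ) ^ 2| ≤ 1 / (k.factorial : ℝ) := by
  have h : (1 : ℝ) ≤ k.factorial := by exact_mod_cast Nat.one_le_iff_ne_zero.2 k.factorial_ne_zero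
  rw [abs_of_nonneg (by positivity)]
  exact one_div_le_one_div_of_le (by positivity) (by nlinarith)

theorem abs_besselSeriesDeriv_coeff_le (k : ℕ) :
    |1 / ((k.factorial : ℝ) * ((k + 1).factorial : ℝ))| ≤ 1 / (k.factorial : ℝ) := by
  have h : (1 : ℝ) ≤ (k + 1).factorial := by
    exact_mod_cast Nat.one_le_iff_ne_zero.2 (k + 1).factorial_ne_zero
  have h' : (0 : ℝ) < k.factorial := by positivity
  rw [abs_of_nonneg (by positivity)]
  exact one_div_le_one_div_of_le h' (by nlinarith)

/-- Only even powers occur in `I₀`, so the square root in `besselTerm` disappears and smoothness in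
`x` and `t` comes from an entire function. -/
theorem besselI0_eq_besselSeries (z : ℝ) : besselI0 z = besselSeries (z ^ 2 / 4) := by
  refine tsum_congr fun k => ?_
  rw [pow_mul, div_pow]
  norm_num
  ring

theorem hasDerivAt_besselSeries (y : ℝ) :
    HasDerivAt besselSeries (besselSeriesDeriv y) y := by
  have heq : besselSeriesDeriv y =
      ∑' k : ℕ, ((k : ℝ) + 1) * (1 / ((k + 1).factorial : ℝ) ^ 2) * y ^ k := by
    refine tsum_congr fun k => ?_
    have : (k.factorial : ℝ) ≠ 0 := by positivity
    rw [Nat.factorial_succ]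
    push_cast
    field_simp
  rw [heq]
  exact hasDerivAt_tsum_mul_pow_of_le_inv_factorial abs_besselSeries_coeff_le y

theorem continuous_besselSeries : Continuous besselSeries :=
  continuous_iff_continuousAt.2 fun y => (hasDerivAt_besselSeries y).continuousAt

theorem continuous_besselSeriesDeriv : Continuous besselSeriesDeriv :=
  continuous_iff_continuousAt.2 fun y =>
    (hasDerivAt_tsum_mul_pow_of_le_inv_factorial abs_besselSeriesDeriv_coeff_le y).continuousAt

theorem hasSum_besselSeries (y : ℝ) :
    HasSum (fun k : ℕ => 1 / (k.factorial : ℝ) ^ 2 * y ^ k) (besselSeries y) :=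
  (summable_mul_pow_of_le_inv_factorial abs_besselSeries_coeff_le y).hasSum

theorem hasSum_besselSeriesDeriv (y : ℝ) :
    HasSum (fun k : ℕ => 1 / ((k.factorial : ℝ) * ((k + 1).factorial : ℝ)) * y ^ k)
      (besselSeriesDeriv y) :=
  (summable_mul_pow_of_le_inv_factorial abs_besselSeriesDeriv_coeff_le y).hasSum

theorem besselSeries_nonneg {y : ℝ} (hy : 0 ≤ y) : 0 ≤ besselSeries y :=
  tsum_nonneg fun _ => by positivity

theorem besselSeriesDeriv_nonneg {y : ℝ} (hy : 0 ≤ y) : 0 ≤ besselSeriesDeriv y :=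
  tsum_nonneg fun _ => by positivity

/-! ### Regularity and series expansion of the density -/

namespace PlanarMotion

theorem sq_sub_sq_pos_of_abs_lt {a x : ℝ} (hx : |x| < a) : 0 < a ^ 2 - x ^ 2 := by
  have := sq_lt_sq' (neg_lt_of_abs_lt hx) (lt_of_abs_lt hx)
  linarith

theorem besselTerm_eq {lam c p q x s : ℝ} (h : 0 ≤ c ^ 2 * s ^ 2 - x ^ 2) :
    besselTerm lam c p q x s =
      besselSeries ((lam * (1 - p - q)) ^ 2 * (c ^ 2 * s ^ 2 - x ^ 2) / (4 * c ^ 2)) := by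
  rw [besselTerm, besselI0_eq_besselSeries, mul_pow, Real.sq_sqrt h]
  congr 1
  ring

theorem hasDerivAt_besselTerm {lam c p q x t : ℝ} (hc : 0 < c) (hx : |x| < c * t) :
    HasDerivAt (fun s => besselTerm lam c p q x s)
      (besselSeriesDeriv ((lam * (1 - p - q)) ^ 2 * (c ^ 2 * t ^ 2 - x ^ 2) / (4 * c ^ 2)) *
        ((lam * (1 - p - q)) ^ 2 * t / 2)) t := by
  have hpos : 0 < c ^ 2 * t ^ 2 - x ^ 2 := by
    have := sq_sub_sq_pos_of_abs_lt hx
    rwa [mul_pow] at this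
  -- The square root cancels only where its argument is nonnegative; strict positivity at `t` makes
  -- this hold for all nearby `s`.
  have hev : (fun s => besselTerm lam c p q x s) =ᶠ[nhds t] fun s =>
      besselSeries ((lam * (1 - p - q)) ^ 2 * (c ^ 2 * s ^ 2 - x ^ 2) / (4 * c ^ 2)) := by
    have hcont : Continuous fun s : ℝ => c ^ 2 * s ^ 2 - x ^ 2 := by fun_prop
    filter_upwards [hcont.continuousAt.eventually (lt_mem_nhds hpos)] with s hs
    exact besselTerm_eq (le_of_lt hs)
  refine HasDerivAt.congr_of_eventuallyEq ?_ hev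
  have hin : HasDerivAt
      (fun s : ℝ => (lam * (1 - p - q)) ^ 2 * (c ^ 2 * s ^ 2 - x ^ 2) / (4 * c ^ 2))
      ((lam * (1 - p - q)) ^ 2 * t / 2) t := by
    have h := ((((hasDerivAt_pow 2 t).const_mul (c ^ 2)).sub_const (x ^ 2)).const_mul
      ((lam * (1 - p - q)) ^ 2)).div_const (4 * c ^ 2)
    refine h.congr_deriv ?_
    field_simp
    norm_num
    ring
  exact (hasDerivAt_besselSeries _).comp t hin

theorem diagDensity_eq {lam c p q x t : ℝ} (hc : 0 < c) (hx : |x| < c * t) :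
    diagDensity lam c p q x t = Real.exp (-lam * t) / (4 * c) *
      (lam * (1 - p - q) *
          besselSeries ((lam * (1 - p - q)) ^ 2 * (c ^ 2 * t ^ 2 - x ^ 2) / (4 * c ^ 2)) +
        besselSeriesDeriv ((lam * (1 - p - q)) ^ 2 * (c ^ 2 * t ^ 2 - x ^ 2) / (4 * c ^ 2)) *
          ((lam * (1 - p - q)) ^ 2 * t / 2)) := by
  have hpos : 0 < c ^ 2 * t ^ 2 - x ^ 2 := by
    have := sq_sub_sq_pos_of_abs_lt hx
    rwa [mul_pow] at this
  rw [diagDensity, (hasDerivAt_besselTerm hc hx).deriv, besselTerm_eq hpos.le]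

theorem diagDensity_nonneg {lam c p q x t : ℝ} (hlam : 0 < lam) (hc : 0 < c) (ht : 0 < t)
    (hpq : p + q < 1) (hx : |x| < c * t) : 0 ≤ diagDensity lam c p q x t := by
  have hpos : 0 < c ^ 2 * t ^ 2 - x ^ 2 := by
    have := sq_sub_sq_pos_of_abs_lt hx
    rwa [mul_pow] at this
  have hr : 0 < 1 - p - q := by linarith
  rw [diagDensity_eq hc hx]
  have h₀ := besselSeries_nonneg
    (y := (lam * (1 - p - q)) ^ 2 * (c ^ 2 * t ^ 2 - x ^ 2) / (4 * c ^ 2)) (by positivity)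
  have h₁ := besselSeriesDeriv_nonneg
    (y := (lam * (1 - p - q)) ^ 2 * (c ^ 2 * t ^ 2 - x ^ 2) / (4 * c ^ 2)) (by positivity)
  positivity

theorem continuousOn_diagDensity {lam c p q t : ℝ} (hc : 0 < c) :
    ContinuousOn (fun x => diagDensity lam c p q x t) (Ioo (-(c * t)) (c * t)) := by
  have h : Continuous fun x : ℝ => Real.exp (-lam * t) / (4 * c) *
      (lam * (1 - p - q) *
          besselSeries ((lam * (1 - p - q)) ^ 2 * (c ^ 2 * t ^ 2 - x ^ 2) / (4 * c ^ 2)) +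
        besselSeriesDeriv ((lam * (1 - p - q)) ^ 2 * (c ^ 2 * t ^ 2 - x ^ 2) / (4 * c ^ 2)) *
          ((lam * (1 - p - q)) ^ 2 * t / 2)) := by
    have h₀ := continuous_besselSeries
    have h₁ := continuous_besselSeriesDeriv
    fun_prop
  exact h.continuousOn.congr fun x hx => diagDensity_eq hc (abs_lt.2 hx)

/-- The density of the alternating motion with `n + 1` flights, on the time spent in the flights
of the parity opposite to the last one. -/
def flightDensity (lam t : ℝ) (n : ℕ) (w : ℝ) : ℝ :=
  lam ^ n * Real.exp (-lam * t) * w ^ ((n - 1) / 2) / ((n - 1) / 2).factorial *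
    (t - w) ^ (n / 2) / (n / 2).factorial

/-- With `u = (t + x / c) / 2` and `v = t - u`, the Bessel variable is `(lam r)² u v`, where `r = 1
- p - q`. For `2k + 1` turns both flight densities are multiples of `(u v) ^ k`, giving
`besselSeries`. For `2k + 2` turns they add up to a multiple of `u ^ k v ^ (k + 1) + v ^ k u ^ (k +
1) = t (u v) ^ k`, giving `besselSeriesDeriv` and explaining its factor `t`. -/
theorem hasSum_diagDensity {lam c p q x t : ℝ} (hc : 0 < c) (hx : |x| < c * t) :
    HasSum (fun n : ℕ => 1 / 4 * (1 - p - q) ^ (n + 1) * (1 / (2 * c)) *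
        (flightDensity lam t (n + 1) ((t + x / c) / 2) +
          flightDensity lam t (n + 1) ((t - x / c) / 2)))
      (diagDensity lam c p q x t) := by
  rw [diagDensity_eq hc hx]
  set r := 1 - p - q
  set y := (lam * r) ^ 2 * (c ^ 2 * t ^ 2 - x ^ 2) / (4 * c ^ 2) with hy
  have hyuv : y = (lam * r) ^ 2 * (((t + x / c) / 2) * ((t - x / c) / 2)) := by
    rw [hy]; field_simp; ring
  set u := (t + x / c) / 2 with hu
  set v := (t - x / c) / 2 with hv
  have htu : t - u = v := by rw [hu, hv]; ring
  have htv : t - v = u := by rw [hu, hv]; ring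
  have huv : u + v = t := by rw [hu, hv]; ring
  have h₀ := (hasSum_besselSeries y).mul_left (Real.exp (-lam * t) / (4 * c) * (lam * r))
  have h₁ := (hasSum_besselSeriesDeriv y).mul_left
    (Real.exp (-lam * t) / (4 * c) * ((lam * r) ^ 2 * t / 2))
  have he : ∀ k : ℕ, 1 / 4 * r ^ (2 * k + 1) * (1 / (2 * c)) *
        (flightDensity lam t (2 * k + 1) u + flightDensity lam t (2 * k + 1) v) =
      Real.exp (-lam * t) / (4 * c) * (lam * r) * (1 / (k.factorial : ℝ) ^ 2 * y ^ k) := by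
    intro k
    have e₁ : (2 * k + 1 - 1) / 2 = k := by omega
    have e₂ : (2 * k + 1) / 2 = k := by omega
    simp only [flightDensity, e₁, e₂, htu, htv]
    rw [hyuv]
    field_simp
    ring_nf
  have ho : ∀ k : ℕ, 1 / 4 * r ^ (2 * k + 1 + 1) * (1 / (2 * c)) *
        (flightDensity lam t (2 * k + 1 + 1) u + flightDensity lam t (2 * k + 1 + 1) v) =
      Real.exp (-lam * t) / (4 * c) * ((lam * r) ^ 2 * t / 2) *
        (1 / ((k.factorial : ℝ) * ((k + 1).factorial : ℝ)) * y ^ k) := by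
    intro k
    have e₁ : (2 * k + 1 + 1 - 1) / 2 = k := by omega
    have e₂ : (2 * k + 1 + 1) / 2 = k + 1 := by omega
    simp only [flightDensity, e₁, e₂, htu, htv]
    rw [hyuv, ← huv]
    field_simp
    ring_nf
  simp only [← he] at h₀
  simp only [← ho] at h₁
  have key := HasSum.even_add_odd (f := fun n : ℕ => 1 / 4 * r ^ (n + 1) * (1 / (2 * c)) *
        (flightDensity lam t (n + 1) u + flightDensity lam t (n + 1) v)) h₀ h₁
  have hval : Real.exp (-lam * t) / (4 * c) * (lam * r * besselSeries y +
      besselSeriesDeriv y * ((lam * r) ^ 2 * t / 2)) =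
      Real.exp (-lam * t) / (4 * c) * (lam * r) * besselSeries y +
        Real.exp (-lam * t) / (4 * c) * ((lam * r) ^ 2 * t / 2) * besselSeriesDeriv y := by
    ring
  rw [hval]
  exact key

end PlanarMotion

/-! ### Sums of independent exponential times -/

section Erlang

/-- The density of the sum of `m + 1` independent exponential variables of rate `lam`. -/
def erlangPDF (lam : ℝ) (m : ℕ) (x : ℝ) : ENNReal :=
  ENNReal.ofReal (if 0 ≤ x then lam ^ (m + 1) * x ^ m / m.factorial * Real.exp (-(lam * x)) else 0)

@[fun_prop]
theorem measurable_erlangPDF (lam : ℝ) (m : ℕ) : Measurable (erlangPDF lam m) := by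
  refine (Measurable.ite measurableSet_Ici ?_ measurable_const).ennreal_ofReal
  fun_prop

theorem erlangPDF_of_neg {lam x : ℝ} (m : ℕ) (hx : x < 0) : erlangPDF lam m x = 0 := by
  simp [erlangPDF, not_le.2 hx]

theorem erlangPDF_of_nonneg {lam x : ℝ} (m : ℕ) (hx : 0 ≤ x) : erlangPDF lam m x =
    ENNReal.ofReal (lam ^ (m + 1) * x ^ m / m.factorial * Real.exp (-(lam * x))) := by
  simp [erlangPDF, hx]

theorem expMeasure_eq_withDensity_erlangPDF (lam : ℝ) :
    expMeasure lam = volume.withDensity (erlangPDF lam 0) := by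
  have h : gammaPDF 1 lam = erlangPDF lam 0 := by
    ext x
    simp [gammaPDF_eq, erlangPDF]
  rw [expMeasure, gammaMeasure, h]

theorem lintegral_Icc_const_mul_pow {C r : ℝ} (hC : 0 ≤ C) (hr : 0 ≤ r) (m : ℕ) :
    ∫⁻ z in Icc 0 r, ENNReal.ofReal (C * z ^ m) = ENNReal.ofReal (C * r ^ (m + 1) / (m + 1)) := by
  rw [← ofReal_integral_eq_lintegral_ofReal, integral_Icc_eq_integral_Ioc,
    ← intervalIntegral.integral_of_le hr, intervalIntegral.integral_const_mul, integral_pow]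
  · congr 1
    simp
    ring
  · exact (Continuous.integrableOn_Icc (by fun_prop))
  · filter_upwards [ae_restrict_mem measurableSet_Icc] with z hz
    have := hz.1
    positivity

theorem expMeasure_Ioi {lam r : ℝ} (hlam : 0 < lam) (hr : 0 ≤ r) :
    expMeasure lam (Ioi r) = ENNReal.ofReal (Real.exp (-(lam * r))) := by
  have := isProbabilityMeasure_expMeasure hlam
  have h := cdf_expMeasure_eq hlam r
  rw [if_pos hr, cdf_eq_real] at h
  rw [← compl_Iic, ← ofReal_measureReal, probReal_compl_eq_one_sub measurableSet_Iic, h]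
  congr 1
  ring

/-- The two exponentials multiply to `exp (-(lam x))`, independent of `y`, so only a monomial is
integrated over `[0, x]`. -/
theorem erlangPDF_lconvolution {lam : ℝ} (hlam : 0 < lam) (m : ℕ) (x : ℝ) :
    ∫⁻ y, erlangPDF lam m y * erlangPDF lam 0 (-y + x) = erlangPDF lam (m + 1) x := by
  have hsupp : (fun y => erlangPDF lam m y * erlangPDF lam 0 (-y + x)) =
      (Icc 0 x).indicator fun y => ENNReal.ofReal
        (lam ^ (m + 2) / m.factorial * Real.exp (-(lam * x)) * y ^ m) := by
    ext y
    by_cases hy : y ∈ Icc 0 x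
    · rw [indicator_of_mem hy, erlangPDF_of_nonneg m hy.1,
        erlangPDF_of_nonneg 0 (by linarith [hy.2]), ← ENNReal.ofReal_mul (by
          have := hy.1
          positivity)]
      congr 1
      have : Real.exp (-(lam * x)) = Real.exp (-(lam * y)) * Real.exp (-(lam * (-y + x))) := by
        rw [← Real.exp_add]; congr 1; ring
      rw [this]
      simp
      ring
    · rw [indicator_of_notMem hy]
      rcases lt_or_ge y 0 with h | h
      · rw [erlangPDF_of_neg m h, zero_mul]
      · have : x < y := by
          by_contra hxy
          exact hy ⟨h, not_lt.1 hxy⟩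
        rw [erlangPDF_of_neg 0 (by linarith), mul_zero]
  rw [hsupp, lintegral_indicator measurableSet_Icc]
  rcases lt_or_ge x 0 with h | h
  · simp [Icc_eq_empty (not_le.2 h), erlangPDF_of_neg _ h]
  · rw [lintegral_Icc_const_mul_pow (by positivity) h, erlangPDF_of_nonneg _ h, Nat.factorial_succ]
    congr 1
    push_cast
    field_simp

variable {Ω : Type*} [MeasurableSpace Ω] {P : Measure Ω}

theorem indepFun_sum_of_disjoint {ι β : Type*} [MeasurableSpace β] {τ : ι → Ω → ℝ}
    (hindep : iIndepFun τ P) (hmeas : ∀ i, Measurable (τ i)) {s u : Finset ι}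
    (hsu : Disjoint s u) {g : (u → ℝ) → β} (hg : Measurable g) :
    IndepFun (fun ω => ∑ i ∈ s, τ i ω) (fun ω => g fun i => τ i ω) P := by
  have h := (hindep.indepFun_finset s u hsu hmeas).comp
    (φ := fun v : s → ℝ => ∑ i, v i) (ψ := g) (by fun_prop) hg
  have hsum : (fun ω => ∑ i ∈ s, τ i ω) =
      (fun v : s → ℝ => ∑ i, v i) ∘ fun ω (i : s) => τ i ω := by
    ext ω
    exact (Finset.sum_coe_sort s fun i => τ i ω).symm
  rw [hsum]
  exact h

theorem map_sum_eq_withDensity_erlangPDF {ι : Type*} {lam : ℝ} (hlam : 0 < lam)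
    {τ : ι → Ω → ℝ} (hindep : iIndepFun τ P) (hmeas : ∀ i, Measurable (τ i))
    (hlaw : ∀ i, P.map (τ i) = expMeasure lam) {s : Finset ι} {m : ℕ} (hs : s.card = m + 1) :
    P.map (fun ω => ∑ i ∈ s, τ i ω) = volume.withDensity (erlangPDF lam m) := by
  classical
  have := hindep.isProbabilityMeasure
  induction m generalizing s with
  | zero =>
    obtain ⟨i, rfl⟩ := Finset.card_eq_one.1 hs
    simpa [expMeasure_eq_withDensity_erlangPDF] using hlaw i
  | succ m ih =>
    obtain ⟨i, u, hi, rfl, hu⟩ := Finset.card_eq_succ.1 hs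
    have e₂ : (∑ j ∈ u, τ j) = fun ω => ∑ j ∈ u, τ j ω := by
      ext ω
      simp
    have hind : IndepFun (∑ j ∈ u, τ j) (τ i) P := hindep.indepFun_finsetSum_of_notMem hmeas hi
    have hmap := hind.map_add_eq_map_conv_map
      (e₂ ▸ Finset.measurable_sum u fun j _ => hmeas j) (hmeas i)
    have e₁ : (fun ω => ∑ j ∈ insert i u, τ j ω) = (∑ j ∈ u, τ j) + τ i := by
      ext ω
      simp [Finset.sum_insert hi, add_comm]
    rw [e₁, hmap, hlaw, e₂, ih hu, expMeasure_eq_withDensity_erlangPDF,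
      conv_withDensity_eq_lconvolution (by fun_prop) (by fun_prop)]
    congr 1
    ext x
    rw [lconvolution_def]
    exact erlangPDF_lconvolution hlam m x

theorem IndepFun.measure_mem_eq_lintegral [IsFiniteMeasure P] {β : Type*} [MeasurableSpace β]
    {X : Ω → ℝ} {Y : Ω → β} (h : IndepFun X Y P) (hX : Measurable X) (hY : Measurable Y)
    {A : Set (ℝ × β)} (hA : MeasurableSet A) :
    P {ω | (X ω, Y ω) ∈ A} = ∫⁻ x, P {ω | (x, Y ω) ∈ A} ∂(P.map X) := by
  have h₁ : P {ω | (X ω, Y ω) ∈ A} = P.map (fun ω => (X ω, Y ω)) A :=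
    (Measure.map_apply (hX.prodMk hY) hA).symm
  rw [h₁, h.map_prod_eq_prod_map_map hX.aemeasurable hY.aemeasurable, Measure.prod_apply hA]
  refine lintegral_congr fun x => ?_
  rw [Measure.map_apply hY (measurable_prodMk_left hA)]
  rfl

theorem IndepFun.measure_mem_eq_lintegral_erlangPDF {ι β : Type*} [MeasurableSpace β] {lam : ℝ}
    (hlam : 0 < lam) {τ : ι → Ω → ℝ} (hindep : iIndepFun τ P) (hmeas : ∀ i, Measurable (τ i))
    (hlaw : ∀ i, P.map (τ i) = expMeasure lam) {s u : Finset ι} {m : ℕ} (hs : s.card = m + 1)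
    (hsu : Disjoint s u) {g : (u → ℝ) → β} (hg : Measurable g) {A : Set (ℝ × β)}
    (hA : MeasurableSet A) :
    P {ω | (∑ i ∈ s, τ i ω, g fun i => τ i ω) ∈ A} =
      ∫⁻ x, erlangPDF lam m x * P {ω | (x, g fun i => τ i ω) ∈ A} := by
  have := hindep.isProbabilityMeasure
  have hY : Measurable fun ω => g fun i : u => τ i ω := by fun_prop
  rw [IndepFun.measure_mem_eq_lintegral (indepFun_sum_of_disjoint hindep hmeas hsu hg)
    (by fun_prop) hY hA, map_sum_eq_withDensity_erlangPDF hlam hindep hmeas hlaw hs,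
    lintegral_withDensity_eq_lintegral_mul _ (by fun_prop)]
  · rfl
  · have := measurable_measure_prodMk_left (ν := P.map fun ω => g fun i : u => τ i ω) hA
    have heq : (fun x => P {ω | (x, g fun i => τ i ω) ∈ A}) =
        fun x => P.map (fun ω => g fun i : u => τ i ω) (Prod.mk x ⁻¹' A) := by
      ext x
      rw [Measure.map_apply hY (measurable_prodMk_left hA)]
      rfl
    rw [heq]
    exact this

/-- The number of renewals of a Poisson process in a time interval is a Poisson variable. -/
theorem measure_sum_le_lt_add {ι : Type*} {lam : ℝ} (hlam : 0 < lam)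
    {τ : ι → Ω → ℝ} (hindep : iIndepFun τ P) (hmeas : ∀ i, Measurable (τ i))
    (hlaw : ∀ i, P.map (τ i) = expMeasure lam) {s : Finset ι} {j : ι} (hj : j ∉ s)
    {r : ℝ} (hr : 0 ≤ r) :
    P {ω | ∑ i ∈ s, τ i ω ≤ r ∧ r < ∑ i ∈ s, τ i ω + τ j ω} =
      ENNReal.ofReal (Real.exp (-(lam * r)) * (lam * r) ^ s.card / s.card.factorial) := by
  have htail : ∀ a : ℝ, 0 ≤ a →
      P {ω | a < τ j ω} = ENNReal.ofReal (Real.exp (-(lam * a))) := fun a ha => by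
    rw [← expMeasure_Ioi hlam ha, ← hlaw j, Measure.map_apply (hmeas j) measurableSet_Ioi]
    rfl
  -- An empty sum has no density, so the case of no renewal is the exponential tail itself.
  rcases hk : s.card with _ | m
  · obtain rfl := Finset.card_eq_zero.1 hk
    simpa [hr] using htail r hr
  · have h := IndepFun.measure_mem_eq_lintegral_erlangPDF hlam hindep hmeas hlaw hk
      (u := {j}) (by simpa using hj) (g := fun v => v ⟨j, by simp⟩) (by fun_prop)
      (A := {x : ℝ × ℝ | x.1 ≤ r ∧ r < x.1 + x.2})
      ((measurableSet_le measurable_fst measurable_const).inter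
        (measurableSet_lt measurable_const (measurable_fst.add measurable_snd)))
    refine h.trans ?_
    have hsupp : (fun x => erlangPDF lam m x * P {ω | (x, τ j ω) ∈
          {x : ℝ × ℝ | x.1 ≤ r ∧ r < x.1 + x.2}}) =
        (Icc 0 r).indicator fun y => ENNReal.ofReal
          (lam ^ (m + 1) / m.factorial * Real.exp (-(lam * r)) * y ^ m) := by
      ext y
      by_cases hy : y ∈ Icc 0 r
      · have hset : {ω | (y, τ j ω) ∈ {x : ℝ × ℝ | x.1 ≤ r ∧ r < x.1 + x.2}} =
            {ω | r - y < τ j ω} := by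
          ext ω
          simp [hy.2, sub_lt_iff_lt_add']
        rw [indicator_of_mem hy, erlangPDF_of_nonneg m hy.1, hset,
          htail _ (sub_nonneg.2 hy.2), ← ENNReal.ofReal_mul (by
            have := hy.1
            positivity)]
        congr 1
        have : Real.exp (-(lam * r)) = Real.exp (-(lam * y)) * Real.exp (-(lam * (r - y))) := by
          rw [← Real.exp_add]; congr 1; ring
        rw [this]
        ring
      · rw [indicator_of_notMem hy]
        rcases lt_or_ge y 0 with h | h
        · rw [erlangPDF_of_neg m h, zero_mul]
        · have hyr : ¬ y ≤ r := fun hyr => hy ⟨h, hyr⟩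
          simp [hyr]
    rw [hsupp, lintegral_indicator measurableSet_Icc,
      lintegral_Icc_const_mul_pow (by positivity) hr, Nat.factorial_succ, mul_pow]
    congr 1
    push_cast
    field_simp

/-- Conditioning on the sum over `s` being `w` leaves the Poisson probability of exactly `u.card`
renewals in time `t - w`, with `j` the interval straddling the end. The exponentials of the Erlang
density and of the Poisson weight combine into `exp (-lam t)`. -/
theorem measure_sum_mem_and_le_lt_add {ι : Type*} [DecidableEq ι] {lam : ℝ} (hlam : 0 < lam)
    {τ : ι → Ω → ℝ} (hindep : iIndepFun τ P) (hmeas : ∀ i, Measurable (τ i))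
    (hlaw : ∀ i, P.map (τ i) = expMeasure lam) {s u : Finset ι} {j : ι} {m : ℕ}
    (hs : s.card = m + 1) (hsu : Disjoint s u) (hjs : j ∉ s) (hju : j ∉ u)
    {t : ℝ} {C : Set ℝ} (hC : MeasurableSet C) (hCt : C ⊆ Icc 0 t) :
    P {ω | ∑ i ∈ s, τ i ω ∈ C ∧ ∑ i ∈ u, τ i ω ≤ t - ∑ i ∈ s, τ i ω ∧
        t - ∑ i ∈ s, τ i ω < ∑ i ∈ u, τ i ω + τ j ω} =
      ∫⁻ w in C, ENNReal.ofReal (lam ^ (m + 1 + u.card) * Real.exp (-lam * t) * w ^ m / m.factorial *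
        (t - w) ^ u.card / u.card.factorial) := by
  have h := IndepFun.measure_mem_eq_lintegral_erlangPDF hlam hindep hmeas hlaw hs
      (u := insert j u) (by simp [Finset.disjoint_insert_right, hjs, hsu])
      (g := fun v => (∑ i : u, v ⟨i, Finset.mem_insert_of_mem i.2⟩,
        v ⟨j, Finset.mem_insert_self j u⟩)) (by fun_prop)
      (A := {x : ℝ × ℝ × ℝ | x.1 ∈ C ∧ x.2.1 ≤ t - x.1 ∧ t - x.1 < x.2.1 + x.2.2})
      ((measurable_fst hC).inter
        ((measurableSet_le (measurable_fst.comp measurable_snd)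
          (measurable_const.sub measurable_fst)).inter
          (measurableSet_lt (measurable_const.sub measurable_fst)
            ((measurable_fst.comp measurable_snd).add (measurable_snd.comp measurable_snd)))))
  have hsum : ∀ ω, ∑ i : u, τ i ω = ∑ i ∈ u, τ i ω := fun ω =>
    Finset.sum_coe_sort u fun i => τ i ω
  simp only [hsum, mem_ofPred_eq] at h
  rw [h, ← lintegral_indicator hC]
  refine lintegral_congr fun w => ?_
  by_cases hw : w ∈ C
  · have hw' := hCt hw
    have h0 := hw'.1
    have h1 : 0 ≤ t - w := sub_nonneg.2 hw'.2
    simp only [hw, true_and]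
    rw [indicator_of_mem hw, measure_sum_le_lt_add hlam hindep hmeas hlaw hju h1,
      erlangPDF_of_nonneg m h0, ← ENNReal.ofReal_mul (by positivity)]
    congr 1
    have : Real.exp (-lam * t) = Real.exp (-(lam * w)) * Real.exp (-(lam * (t - w))) := by
      rw [← Real.exp_add]; congr 1; ring
    rw [this, mul_pow]
    ring
  · simp [hw]

end Erlang

namespace PlanarMotion

variable {Ω : Type*}

/-! ### Trajectories as sums over flights -/

section Path

variable {τ : ℕ → Ω → ℝ} {ω : Ω}

theorem arrival_succ (n : ℕ) : arrival τ (n + 1) ω = arrival τ n ω + τ n ω :=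
  Finset.sum_range_succ _ _

theorem strictMono_arrival (hpos : ∀ i, 0 < τ i ω) : StrictMono fun n => arrival τ n ω :=
  strictMono_nat_of_lt_succ fun n => by
    rw [arrival_succ]
    linarith [hpos n]

theorem count_eq (hpos : ∀ i, 0 < τ i ω) {n : ℕ} {s : ℝ} (h₁ : arrival τ n ω ≤ s)
    (h₂ : s < arrival τ (n + 1) ω) : count τ s ω = n := by
  have hset : {m : ℕ | 1 ≤ m ∧ arrival τ m ω ≤ s} = (Finset.Icc 1 n : Finset ℕ) := by
    ext m
    simp only [mem_ofPred_eq, Finset.coe_Icc, mem_Icc, and_congr_right_iff]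
    refine fun _ => ⟨fun hm => ?_, fun hm => ?_⟩
    · have := (strictMono_arrival hpos).lt_iff_lt.1 (lt_of_le_of_lt hm h₂)
      omega
    · exact ((strictMono_arrival hpos).monotone hm).trans h₁
  rw [count, hset, Set.ncard_coe_finset, Nat.card_Icc, Nat.add_sub_cancel]

/-- The direction index after the first `m` turns. -/
def turnIndex (J₀ : Ω → ℤ) (ξ : ℕ → Ω → ℤ) (m : ℕ) (ω : Ω) : ℤ :=
  J₀ ω + ∑ k ∈ Finset.range m, ξ k ω

/-- The direction is constant inside each flight; endpoints do not affect the integral. A general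
`f` serves both the cosine and the sine. -/
theorem integral_comp_dirIndex (J₀ : Ω → ℤ) (ξ : ℕ → Ω → ℤ) (hpos : ∀ i, 0 < τ i ω)
    {n : ℕ} {t : ℝ} (h₁ : arrival τ n ω ≤ t) (h₂ : t < arrival τ (n + 1) ω) (f : ℤ → ℝ) :
    ∫ s in (0 : ℝ)..t, f (dirIndex J₀ τ ξ s ω) =
      ∑ m ∈ Finset.range n, τ m ω * f (turnIndex J₀ ξ m ω) +
        (t - arrival τ n ω) * f (turnIndex J₀ ξ n ω) := by
  have hconst : ∀ (m : ℕ) (b : ℝ), arrival τ m ω ≤ b → b ≤ arrival τ (m + 1) ω →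
      EqOn (fun _ => f (turnIndex J₀ ξ m ω)) (fun s => f (dirIndex J₀ τ ξ s ω))
        (uIoo (arrival τ m ω) b) := by
    intro m b hb hb' s hs
    rw [uIoo_of_le hb] at hs
    simp only [dirIndex, count_eq hpos hs.1.le (hs.2.trans_le hb'), turnIndex]
  have hint : ∀ (m : ℕ) (b : ℝ), arrival τ m ω ≤ b → b ≤ arrival τ (m + 1) ω →
      IntervalIntegrable (fun s => f (dirIndex J₀ τ ξ s ω)) volume (arrival τ m ω) b :=
    fun m b hb hb' => intervalIntegrable_const.congr_uIoo (hconst m b hb hb')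
  have hval : ∀ (m : ℕ) (b : ℝ), arrival τ m ω ≤ b → b ≤ arrival τ (m + 1) ω →
      ∫ s in arrival τ m ω..b, f (dirIndex J₀ τ ξ s ω) =
        (b - arrival τ m ω) * f (turnIndex J₀ ξ m ω) := fun m b hb hb' => by
    rw [← intervalIntegral.integral_congr_uIoo (hconst m b hb hb')]
    simp
  have hmono : ∀ m, arrival τ m ω ≤ arrival τ (m + 1) ω :=
    fun m => (strictMono_arrival hpos).monotone m.le_succ
  have hsum := intervalIntegral.sum_integral_adjacent_intervals (n := n)
    (fun m _ => hint m _ (hmono m) le_rfl)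
  have hint₀ : IntervalIntegrable (fun s => f (dirIndex J₀ τ ξ s ω)) volume
      (arrival τ 0 ω) (arrival τ n ω) :=
    IntervalIntegrable.trans_iterate fun m _ => hint m _ (hmono m) le_rfl
  have h0 : arrival τ 0 ω = 0 := by simp [arrival]
  rw [← h0, ← intervalIntegral.integral_add_adjacent_intervals hint₀ (hint n t h₁ h₂.le), ← hsum,
    hval n t h₁ h₂.le]
  congr 1
  refine Finset.sum_congr rfl fun m _ => ?_
  rw [hval m _ (hmono m) le_rfl, arrival_succ]
  ring

theorem exists_sin_eq_intCast (j : ℤ) :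
    ∃ e : ℤ, Real.sin (Real.pi / 2 * j) = e ∧ (e = 0 ↔ Even j) := by
  rcases Int.even_or_odd' j with ⟨k, rfl | rfl⟩
  · refine ⟨0, ?_, by simp⟩
    have : Real.pi / 2 * ((2 * k : ℤ) : ℝ) = k * Real.pi := by push_cast; ring
    rw [this, Real.sin_int_mul_pi]
    simp
  · have : Real.pi / 2 * ((2 * k + 1 : ℤ) : ℝ) = k * Real.pi + Real.pi / 2 := by push_cast; ring
    rw [this, Real.sin_add_pi_div_two, Real.cos_int_mul_pi]
    rcases Int.even_or_odd k with hk | hk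
    · exact ⟨1, by simp [hk.neg_one_zpow], by simp⟩
    · exact ⟨-1, by simp [hk.neg_one_zpow], by simp⟩

/-- Since the last flight lasts `t` minus the earlier ones, `posY / c` equals `∑ (e_i - e_n) τ_i +
e_n t`, where `e_i` is the integer sine of the `i`-th direction. By `hgen`, vanishing forces all
`e_i = e_n`; then `e_n t = 0`, so every sine vanishes. -/
theorem posY_eq_zero_iff {c : ℝ} (hc : 0 < c) (J₀ : Ω → ℤ) (ξ : ℕ → Ω → ℤ)
    (hpos : ∀ i, 0 < τ i ω) {n : ℕ} {t : ℝ} (ht : 0 < t) (h₁ : arrival τ n ω ≤ t)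
    (h₂ : t < arrival τ (n + 1) ω)
    (hgen : ∀ (a : Fin n → ℤ) (b : ℤ), a ≠ 0 → ∑ i, (a i : ℝ) * τ i ω ≠ b * t) :
    posY c J₀ τ ξ t ω = 0 ↔ ∀ m ≤ n, Even (turnIndex J₀ ξ m ω) := by
  choose e he he0 using exists_sin_eq_intCast
  have hY : posY c J₀ τ ξ t ω = c * (∑ m ∈ Finset.range n, τ m ω * e (turnIndex J₀ ξ m ω) +
      (t - arrival τ n ω) * e (turnIndex J₀ ξ n ω)) := by
    rw [posY, intervalIntegral.integral_const_mul]
    simp only [he]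
    rw [integral_comp_dirIndex J₀ ξ hpos h₁ h₂ fun j => (e j : ℝ)]
  have hexp : ∑ m ∈ Finset.range n, τ m ω * e (turnIndex J₀ ξ m ω) +
      (t - arrival τ n ω) * e (turnIndex J₀ ξ n ω) =
      ∑ i : Fin n, ((e (turnIndex J₀ ξ i ω) - e (turnIndex J₀ ξ n ω) : ℤ) : ℝ) * τ i ω +
        e (turnIndex J₀ ξ n ω) * t := by
    rw [Fin.sum_univ_eq_sum_range
      (fun i => ((e (turnIndex J₀ ξ i ω) - e (turnIndex J₀ ξ n ω) : ℤ) : ℝ) * τ i ω), arrival,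
      sub_mul, Finset.sum_mul]
    have : ∀ i, ((e (turnIndex J₀ ξ i ω) - e (turnIndex J₀ ξ n ω) : ℤ) : ℝ) * τ i ω =
        τ i ω * e (turnIndex J₀ ξ i ω) - τ i ω * e (turnIndex J₀ ξ n ω) := fun i => by
      push_cast; ring
    simp only [this, Finset.sum_sub_distrib]
    ring
  rw [hY, mul_eq_zero, or_iff_right hc.ne', hexp]
  constructor
  · intro h
    have ha : (fun i : Fin n => e (turnIndex J₀ ξ i ω) - e (turnIndex J₀ ξ n ω)) = 0 := by
      by_contra hne
      refine hgen _ (-e (turnIndex J₀ ξ n ω)) hne ?_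
      push_cast at h ⊢
      linarith
    have hn : e (turnIndex J₀ ξ n ω) = 0 := by
      have h' : ∀ i : Fin n, e (turnIndex J₀ ξ i ω) - e (turnIndex J₀ ξ n ω) = 0 :=
        fun i => congrFun ha i
      simp only [h', Int.cast_zero, zero_mul, Finset.sum_const_zero, zero_add, mul_eq_zero,
        ht.ne', or_false] at h
      exact_mod_cast h
    intro m hm
    rw [← he0]
    rcases hm.lt_or_eq with hm | rfl
    · have := congrFun ha ⟨m, hm⟩
      simpa [hn] using this
    · exact hn
  · intro h
    rw [(he0 _).2 (h n le_rfl)]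
    have h' : ∀ i : Fin n, e (turnIndex J₀ ξ i ω) = 0 := fun i => (he0 _).2 (h i i.2.le)
    simp [h']

end Path

/-! ### Alternating flights sorted by parity -/

section Parity

/-- The flights before the last one that have its parity. -/
def inPhase (n : ℕ) : Finset ℕ := (Finset.range n).filter fun i => i % 2 = n % 2

/-- The flights before the last one that have the opposite parity. -/
def offPhase (n : ℕ) : Finset ℕ := (Finset.range n).filter fun i => ¬ i % 2 = n % 2

theorem disjoint_offPhase_inPhase (n : ℕ) : Disjoint (offPhase n) (inPhase n) :=
  (Finset.disjoint_filter_filter_not _ _ _).symm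

theorem notMem_inPhase (n : ℕ) : n ∉ inPhase n := by simp [inPhase]

theorem notMem_offPhase (n : ℕ) : n ∉ offPhase n := by simp [offPhase]

theorem card_inPhase_and_card_offPhase (n : ℕ) :
    (inPhase n).card = n / 2 ∧ (offPhase n).card = (n + 1) / 2 := by
  induction n with
  | zero => simp [inPhase, offPhase]
  | succ n ih =>
    -- One more flight exchanges the two classes, and flight `n` joins the opposite one.
    have h₁ : inPhase (n + 1) = offPhase n := by
      ext i
      simp only [inPhase, offPhase, Finset.mem_filter, Finset.mem_range]
      omega
    have h₂ : offPhase (n + 1) = insert n (inPhase n) := by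
      ext i
      simp only [inPhase, offPhase, Finset.mem_filter, Finset.mem_range, Finset.mem_insert]
      omega
    rw [h₁, h₂, Finset.card_insert_of_notMem (notMem_inPhase n), ih.1, ih.2]
    omega

theorem sum_inPhase_add_sum_offPhase (n : ℕ) (f : ℕ → ℝ) :
    ∑ i ∈ inPhase n, f i + ∑ i ∈ offPhase n, f i = ∑ i ∈ Finset.range n, f i :=
  Finset.sum_filter_add_sum_filter_not _ _ _

theorem neg_one_pow_congr {i n : ℕ} (h : i % 2 = n % 2) : (-1 : ℝ) ^ i = (-1) ^ n := by
  rw [neg_one_pow_eq_pow_mod_two, h, ← neg_one_pow_eq_pow_mod_two]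

theorem sum_alternating_eq (n : ℕ) (f : ℕ → ℝ) :
    ∑ i ∈ Finset.range n, f i * (-1) ^ i =
      (-1) ^ n * (∑ i ∈ inPhase n, f i - ∑ i ∈ offPhase n, f i) := by
  rw [← sum_inPhase_add_sum_offPhase, mul_sub, Finset.mul_sum, Finset.mul_sum, sub_eq_add_neg,
    ← Finset.sum_neg_distrib]
  congr 1
  · refine Finset.sum_congr rfl fun i hi => ?_
    rw [neg_one_pow_congr (Finset.mem_filter.1 hi).2, mul_comm]
  · refine Finset.sum_congr rfl fun i hi => ?_
    have : (i + 1) % 2 = n % 2 := by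
      have := (Finset.mem_filter.1 hi).2
      omega
    rw [← neg_one_pow_congr this, pow_succ]
    ring

/-- Under reflections alone the velocity changes sign at each turn. Flights in phase with the last
one, itself included, fill `t - W`, and the others fill `W` in the opposite direction, for a net
displacement `c (t - 2 W)` along the last direction. -/
theorem posX_eq {τ : ℕ → Ω → ℝ} {ω : Ω} (c : ℝ) {J₀ : Ω → ℤ} {ξ : ℕ → Ω → ℤ}
    (hpos : ∀ i, 0 < τ i ω) {n : ℕ} {t : ℝ} (h₁ : arrival τ n ω ≤ t)
    (h₂ : t < arrival τ (n + 1) ω) {j : ℕ} (hJ : J₀ ω = 2 * j) (hξ : ∀ m < n, ξ m ω = 2) :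
    posX c J₀ τ ξ t ω =
      (-1) ^ (j + n) * c * (t - 2 * ∑ i ∈ offPhase n, τ i ω) := by
  have hturn : ∀ m ≤ n,
      Real.cos (Real.pi / 2 * (turnIndex J₀ ξ m ω : ℝ)) = (-1) ^ j * (-1) ^ m := by
    intro m hm
    have hm' : turnIndex J₀ ξ m ω = 2 * ((j + m : ℕ) : ℤ) := by
      rw [turnIndex, hJ, Finset.sum_congr rfl
        (fun k hk => hξ k ((Finset.mem_range.1 hk).trans_le hm))]
      simp
      ring
    have : Real.pi / 2 * (turnIndex J₀ ξ m ω : ℝ) = ((j + m : ℕ) : ℝ) * Real.pi := by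
      rw [hm']; push_cast; ring
    rw [this, Real.cos_nat_mul_pi, pow_add]
  rw [posX, intervalIntegral.integral_const_mul,
    integral_comp_dirIndex J₀ ξ hpos h₁ h₂ fun j => Real.cos (Real.pi / 2 * (j : ℝ)),
    hturn n le_rfl, Finset.sum_congr rfl
      (fun m hm => by rw [hturn m (Finset.mem_range.1 hm).le])]
  have hs : ∑ m ∈ Finset.range n, τ m ω * ((-1) ^ j * (-1) ^ m) =
      (-1) ^ j * ∑ m ∈ Finset.range n, τ m ω * (-1) ^ m := by
    rw [Finset.mul_sum]
    exact Finset.sum_congr rfl fun m _ => by ring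
  rw [hs, sum_alternating_eq n fun i => τ i ω, arrival,
    ← sum_inPhase_add_sum_offPhase n fun i => τ i ω, pow_add]
  ring

end Parity

/-! ### Null events of the driving randomness -/

section AlmostSure

variable [MeasurableSpace Ω] {P : Measure Ω} {lam p q : ℝ} {J₀ : Ω → ℤ} {τ : ℕ → Ω → ℝ}
  {ξ : ℕ → Ω → ℤ}

theorem IsDriving.measure_time_eq (h : IsDriving P lam p q J₀ τ ξ) (i : ℕ) (a : ℝ) :
    P {ω | τ i ω = a} = 0 := by
  have hm : P.map (τ i) {a} = 0 := by
    rw [h.law_time, expMeasure_eq_withDensity_erlangPDF]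
    exact withDensity_absolutelyContinuous _ _ (measure_singleton a)
  rwa [Measure.map_apply (h.measurable_time i) (measurableSet_singleton a)] at hm

theorem IsDriving.ae_time_pos (h : IsDriving P lam p q J₀ τ ξ) :
    ∀ᵐ ω ∂P, ∀ i, 0 < τ i ω := by
  refine ae_all_iff.2 fun i => ?_
  have hm : ∀ᵐ x ∂(P.map (τ i)), 0 < x := by
    rw [h.law_time, expMeasure_eq_withDensity_erlangPDF,
      ae_withDensity_iff (measurable_erlangPDF lam 0)]
    filter_upwards [Measure.ae_ne volume (0 : ℝ)] with x hx hx'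
    rcases lt_or_gt_of_ne hx with h | h
    · exact absurd (erlangPDF_of_neg 0 h) hx'
    · exact h
  exact ae_of_ae_map (h.measurable_time i).aemeasurable hm

/-- There are countably many relations to exclude. For each, pick an index with nonzero coefficient
and fix the sum of the other terms: that one exponential time must then hit a single point. -/
theorem IsDriving.ae_ne_of_ne_zero (h : IsDriving P lam p q J₀ τ ξ) (t : ℝ) :
    ∀ᵐ ω ∂P, ∀ (n : ℕ) (a : Fin n → ℤ) (b : ℤ), a ≠ 0 →
      ∑ i, (a i : ℝ) * τ i ω ≠ b * t := by
  refine ae_all_iff.2 fun n => ae_all_iff.2 fun a => ae_all_iff.2 fun b => ?_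
  by_cases ha : a = 0
  · simp [ha]
  obtain ⟨i, hi⟩ := Function.ne_iff.1 ha
  have := h.indep_time.isProbabilityMeasure
  have hi' : (a i : ℝ) ≠ 0 := by exact_mod_cast hi
  have hind : iIndepFun (fun (k : Fin n) ω => (a k : ℝ) * τ k ω) P :=
    (h.indep_time.precomp Fin.val_injective).comp (fun k x => (a k : ℝ) * x)
      fun k => measurable_const_mul _
  have hmeas : ∀ k : Fin n, Measurable fun ω => (a k : ℝ) * τ k ω :=
    fun k => (h.measurable_time k).const_mul _
  have key := IndepFun.measure_mem_eq_lintegral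
    (indepFun_sum_of_disjoint hind hmeas (s := Finset.univ.erase i) (u := {i}) (by simp)
      (g := fun v => v ⟨i, by simp⟩) (by fun_prop)) (by fun_prop) (hmeas i)
    (A := {x : ℝ × ℝ | x.1 + x.2 = b * t})
    (measurableSet_eq_fun (by fun_prop) (by fun_prop))
  have hzero : ∀ x : ℝ, P {ω | (x, (a i : ℝ) * τ i ω) ∈ {x : ℝ × ℝ | x.1 + x.2 = b * t}} = 0 := by
    intro x
    refine measure_mono_null (fun ω hω => ?_) (h.measure_time_eq i ((b * t - x) / a i))
    simp only [mem_ofPred_eq] at hω ⊢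
    field_simp
    linarith
  simp only [hzero, lintegral_zero] at key
  rw [ae_iff]
  refine measure_mono_null (fun ω hω => ?_) key
  simp only [mem_ofPred_eq, ne_eq, not_forall, not_not] at hω ⊢
  rw [Finset.sum_erase_add _ _ (Finset.mem_univ i)]
  exact hω.2

/-- The events of exactly `n` arrivals are almost surely disjoint, and their Poisson probabilities
sum to 1, so explosion is a null event. -/
theorem IsDriving.ae_exists_arrival (h : IsDriving P lam p q J₀ τ ξ) (hlam : 0 < lam) {t : ℝ}
    (ht : 0 ≤ t) : ∀ᵐ ω ∂P, ∃ n, arrival τ n ω ≤ t ∧ t < arrival τ (n + 1) ω := by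
  have := h.indep_time.isProbabilityMeasure
  have hmeasA : ∀ n, Measurable fun ω => arrival τ n ω := fun n =>
    Finset.measurable_sum _ fun i _ => h.measurable_time i
  have hmeas : ∀ n, MeasurableSet {ω | arrival τ n ω ≤ t ∧ t < arrival τ (n + 1) ω} := fun n =>
    (measurableSet_le (hmeasA n) measurable_const).inter
      (measurableSet_lt measurable_const (hmeasA (n + 1)))
  have hdisj : Pairwise (Function.onFun (AEDisjoint P)
      fun n => {ω | arrival τ n ω ≤ t ∧ t < arrival τ (n + 1) ω}) := by
    intro n m hnm
    have hnull : P {ω | ¬ ∀ i, 0 < τ i ω} = 0 := ae_iff.1 h.ae_time_pos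
    refine measure_mono_null (fun ω hω => ?_) hnull
    intro hpos
    refine hnm ?_
    rw [← count_eq hpos hω.1.1 hω.1.2, ← count_eq hpos hω.2.1 hω.2.2]
  have hval : ∀ n, P {ω | arrival τ n ω ≤ t ∧ t < arrival τ (n + 1) ω} =
      ENNReal.ofReal (Real.exp (-(lam * t)) * ((lam * t) ^ n / n.factorial)) := fun n => by
    have := measure_sum_le_lt_add hlam h.indep_time h.measurable_time h.law_time
      (s := Finset.range n) (j := n) (by simp) ht
    rw [Finset.card_range, mul_div_assoc] at this
    rw [← this]
    simp only [arrival, Finset.sum_range_succ]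
  have hsum : HasSum (fun n : ℕ => Real.exp (-(lam * t)) * ((lam * t) ^ n / n.factorial)) 1 := by
    have := (NormedSpace.expSeries_div_hasSum_exp (lam * t)).mul_left (Real.exp (-(lam * t)))
    rwa [← Real.exp_eq_exp_ℝ, ← Real.exp_add, neg_add_cancel, Real.exp_zero] at this
  have hone : P (⋃ n, {ω | arrival τ n ω ≤ t ∧ t < arrival τ (n + 1) ω}) = 1 := by
    rw [measure_iUnion₀ hdisj fun n => (hmeas n).nullMeasurableSet]
    simp only [hval]
    rw [← ENNReal.ofReal_tsum_of_nonneg (fun n => by positivity) hsum.summable, hsum.tsum_eq,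
      ENNReal.ofReal_one]
  have hae := (prob_compl_eq_zero_iff (MeasurableSet.iUnion hmeas)).2 hone
  rw [ae_iff]
  refine measure_mono_null (fun ω hω => ?_) hae
  simpa using hω

theorem IsDriving.ae_init_mem (h : IsDriving P lam p q J₀ τ ξ) :
    ∀ᵐ ω ∂P, 0 ≤ J₀ ω ∧ J₀ ω ≤ 3 := by
  have := h.indep_time.isProbabilityMeasure
  have hone : P {ω | J₀ ω ∈ Finset.Icc (0 : ℤ) 3} = 1 := by
    have h₁ : P.map J₀ (Finset.Icc (0 : ℤ) 3 : Finset ℤ) = 1 := by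
      rw [← sum_measure_singleton]
      have : ∀ j ∈ Finset.Icc (0 : ℤ) 3, P.map J₀ {j} = 1 / 4 := fun j hj => by
        rw [Measure.map_apply h.measurable_init (measurableSet_singleton j)]
        exact h.law_init j (Finset.mem_Icc.1 hj).1 (Finset.mem_Icc.1 hj).2
      rw [Finset.sum_congr rfl this]
      simp
      exact ENNReal.mul_inv_cancel (by simp) (by simp)
    rwa [Measure.map_apply h.measurable_init (Finset.measurableSet _)] at h₁
  have hms : MeasurableSet {ω | J₀ ω ∈ Finset.Icc (0 : ℤ) 3} :=
    h.measurable_init (Finset.measurableSet _)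
  have := (prob_compl_eq_zero_iff hms).2 hone
  filter_upwards [measure_eq_zero_iff_ae_notMem.1 this] with ω hω
  simpa using hω

theorem IsDriving.ae_turn_mem (h : IsDriving P lam p q J₀ τ ξ) (hp : 0 ≤ p) (hq : 0 ≤ q)
    (hpq : p + q < 1) : ∀ᵐ ω ∂P, ∀ n, ξ n ω = 1 ∨ ξ n ω = -1 ∨ ξ n ω = 2 := by
  have := h.indep_time.isProbabilityMeasure
  refine ae_all_iff.2 fun n => ?_
  have hone : P {ω | ξ n ω ∈ ({1, -1, 2} : Finset ℤ)} = 1 := by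
    have h₁ : P.map (ξ n) ({1, -1, 2} : Finset ℤ) = 1 := by
      rw [← sum_measure_singleton]
      simp only [Measure.map_apply (h.measurable_turn n) (measurableSet_singleton _)]
      rw [Finset.sum_insert (by decide), Finset.sum_insert (by decide), Finset.sum_singleton]
      have e₁ : P (ξ n ⁻¹' {1}) = ENNReal.ofReal p := h.law_counterclockwise n
      have e₂ : P (ξ n ⁻¹' {-1}) = ENNReal.ofReal q := h.law_clockwise n
      have e₃ : P (ξ n ⁻¹' {2}) = ENNReal.ofReal (1 - p - q) := h.law_reflection n
      rw [e₁, e₂, e₃, ← ENNReal.ofReal_add hq (by linarith), ← ENNReal.ofReal_add hp (by linarith),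
        ← ENNReal.ofReal_one]
      congr 1
      ring
    rwa [Measure.map_apply (h.measurable_turn n) (Finset.measurableSet _)] at h₁
  have hms : MeasurableSet {ω | ξ n ω ∈ ({1, -1, 2} : Finset ℤ)} :=
    h.measurable_turn n (Finset.measurableSet _)
  have := (prob_compl_eq_zero_iff hms).2 hone
  filter_upwards [measure_eq_zero_iff_ae_notMem.1 this] with ω hω
  have hω' : ξ n ω ∈ ({1, -1, 2} : Finset ℤ) := not_not.1 hω
  simpa using hω'

end AlmostSure

/-! ### Law of the alternating motion and summation over the number of turns -/

section Alternating

/-- The durations `w` for which the point `ε c (t - 2 w)` lies in `B`. -/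
def durations (c t ε : ℝ) (B : Set ℝ) : Set ℝ := {w | ε * c * (t - 2 * w) ∈ B}

theorem measurableSet_durations {B : Set ℝ} (hB : MeasurableSet B) (c t ε : ℝ) :
    MeasurableSet (durations c t ε B) :=
  (show Measurable fun w : ℝ => ε * c * (t - 2 * w) by fun_prop) hB

theorem durations_subset_Icc {c t ε : ℝ} (hc : 0 < c) (hε : ε = 1 ∨ ε = -1) {B : Set ℝ}
    (hB : B ⊆ Ioo (-(c * t)) (c * t)) : durations c t ε B ⊆ Icc 0 t := by
  intro w hw
  have h := hB hw
  rcases hε with rfl | rfl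
  · exact ⟨by nlinarith [h.1, h.2], by nlinarith [h.1, h.2]⟩
  · exact ⟨by nlinarith [h.1, h.2], by nlinarith [h.1, h.2]⟩

theorem lintegral_durations {c t ε : ℝ} (hc : 0 < c) (hε : ε = 1 ∨ ε = -1) {B : Set ℝ}
    (hB : MeasurableSet B) (f : ℝ → ENNReal) :
    ∫⁻ w in durations c t ε B, f w =
      ∫⁻ x in B, ENNReal.ofReal (1 / (2 * c)) * f ((t - ε * x / c) / 2) := by
  have hε2 : ε * ε = 1 := by rcases hε with rfl | rfl <;> norm_num
  have hε0 : ε ≠ 0 := fun h => by simp [h] at hε2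
  have himage : durations c t ε B = (fun x => (t - ε * x / c) / 2) '' B := by
    ext w
    constructor
    · intro hw
      refine ⟨ε * c * (t - 2 * w), hw, ?_⟩
      have : ε * (ε * c * (t - 2 * w)) = c * (t - 2 * w) := by
        linear_combination c * (t - 2 * w) * hε2
      simp only [this]
      field_simp
      ring
    · rintro ⟨x, hx, rfl⟩
      have : ε * c * (t - 2 * ((t - ε * x / c) / 2)) = x := by
        field_simp
        linear_combination x * hε2
      change ε * c * (t - 2 * ((t - ε * x / c) / 2)) ∈ B
      rwa [this]
  have hinj : InjOn (fun x => (t - ε * x / c) / 2) B := by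
    intro x _ y _ hxy
    have h : ε * x / c = ε * y / c := by
      simp only at hxy
      linarith
    field_simp at h
    exact h
  have hder : ∀ x ∈ B, HasDerivWithinAt (fun x => (t - ε * x / c) / 2) (-(ε * 1 / c) / 2) B x :=
    fun x _ => ((((hasDerivAt_id x).const_mul ε).div_const c).const_sub t |>.div_const
      2).hasDerivWithinAt
  rw [himage, lintegral_image_eq_lintegral_abs_deriv_mul hB hder hinj]
  have habs : |-(ε * 1 / c) / 2| = 1 / (2 * c) := by
    have : |ε| = 1 := by rcases hε with rfl | rfl <;> norm_num
    rw [abs_div, abs_neg, abs_div, mul_one, this, abs_of_pos hc]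
    norm_num
    ring
  rw [habs]

variable {Ω : Type*}

/-- The event that there are `n` turns before time `t`, all of them reflections, that the initial
direction is `d_{2j}` and that the abscissa at time `t` is in `B`. -/
def alternatingEvent (c : ℝ) (J₀ : Ω → ℤ) (τ : ℕ → Ω → ℝ) (ξ : ℕ → Ω → ℤ) (t : ℝ) (B : Set ℝ)
    (n j : ℕ) : Set Ω :=
  {ω | J₀ ω = 2 * j} ∩ ({ω | ∀ m < n, ξ m ω = 2} ∩
    {ω | ∑ i ∈ offPhase n, τ i ω ∈ durations c t ((-1) ^ (j + n)) B ∧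
      ∑ i ∈ inPhase n, τ i ω ≤ t - ∑ i ∈ offPhase n, τ i ω ∧
        t - ∑ i ∈ offPhase n, τ i ω < ∑ i ∈ inPhase n, τ i ω + τ n ω})

/-- The event is defined through phase sums, which suit the independence arguments; this recovers
the trajectory when all times are positive. -/
theorem mem_alternatingEvent_iff {c : ℝ} {J₀ : Ω → ℤ} {τ : ℕ → Ω → ℝ} {ξ : ℕ → Ω → ℤ} {t : ℝ}
    {B : Set ℝ} {n j : ℕ} {ω : Ω} (hpos : ∀ i, 0 < τ i ω) :
    ω ∈ alternatingEvent c J₀ τ ξ t B n j ↔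
      J₀ ω = 2 * j ∧ (∀ m < n, ξ m ω = 2) ∧ posX c J₀ τ ξ t ω ∈ B ∧
        arrival τ n ω ≤ t ∧ t < arrival τ (n + 1) ω := by
  have hsum := sum_inPhase_add_sum_offPhase n fun i => τ i ω
  have h₁ : ∑ i ∈ inPhase n, τ i ω ≤ t - ∑ i ∈ offPhase n, τ i ω ↔ arrival τ n ω ≤ t := by
    rw [arrival, ← hsum, le_sub_iff_add_le]
  have h₂ : t - ∑ i ∈ offPhase n, τ i ω < ∑ i ∈ inPhase n, τ i ω + τ n ω ↔
      t < arrival τ (n + 1) ω := by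
    rw [arrival_succ, arrival, ← hsum, sub_lt_iff_lt_add]
    constructor <;> intro h <;> linarith
  simp only [alternatingEvent, mem_inter_iff, mem_ofPred_eq, h₁, h₂]
  refine and_congr_right fun hJ => and_congr_right fun hξ => and_congr_left fun hA => ?_
  rw [posX_eq c hpos hA.1 hA.2 hJ hξ]
  rfl

variable [MeasurableSpace Ω] {P : Measure Ω} {lam p q : ℝ} {J₀ : Ω → ℤ} {τ : ℕ → Ω → ℝ}
  {ξ : ℕ → Ω → ℤ}

theorem IsDriving.measurableSet_alternatingEvent (h : IsDriving P lam p q J₀ τ ξ) (c t : ℝ)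
    {B : Set ℝ} (hB : MeasurableSet B) (n j : ℕ) :
    MeasurableSet (alternatingEvent c J₀ τ ξ t B n j) := by
  have hτ := h.measurable_time
  have hW : ∀ s : Finset ℕ, Measurable fun ω => ∑ i ∈ s, τ i ω := fun s => by fun_prop
  refine (h.measurable_init (measurableSet_singleton _)).inter
    (MeasurableSet.inter ?_ ((hW _ (measurableSet_durations hB c t _)).inter
      ((measurableSet_le (hW _) (measurable_const.sub (hW _))).inter
        (measurableSet_lt (measurable_const.sub (hW _)) ((hW _).add (hτ _))))))
  simp only [ofPred_forall]
  exact MeasurableSet.iInter fun m => MeasurableSet.iInter fun _ =>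
    h.measurable_turn m (measurableSet_singleton 2)

theorem IsDriving.measure_reflections (h : IsDriving P lam p q J₀ τ ξ) (n : ℕ) :
    P {ω | ∀ m < n, ξ m ω = 2} = ENNReal.ofReal (1 - p - q) ^ n := by
  have hI := h.indep_turn.measure_inter_preimage_eq_mul (Finset.range n)
    (sets := fun _ => {2}) fun _ _ => measurableSet_singleton _
  have hset : {ω | ∀ m < n, ξ m ω = 2} = ⋂ i ∈ Finset.range n, ξ i ⁻¹' {2} := by
    ext ω
    simp
  have hval : ∀ i ∈ Finset.range n, P (ξ i ⁻¹' {2}) = ENNReal.ofReal (1 - p - q) :=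
    fun i _ => h.law_reflection i
  rw [hset, hI, Finset.prod_congr rfl hval]
  simp

/-- Initial direction, turns and times are independent, so the probability is a product of three
factors; the time factor is carried from durations to abscissas. At least one turn is needed for `W`
to have a density. -/
theorem IsDriving.measure_alternatingEvent (h : IsDriving P lam p q J₀ τ ξ) (hlam : 0 < lam)
    {c t : ℝ} (hc : 0 < c) {B : Set ℝ} (hB : MeasurableSet B)
    (hBt : B ⊆ Ioo (-(c * t)) (c * t)) (n : ℕ) {j : ℕ} (hj : j < 2) :
    P (alternatingEvent c J₀ τ ξ t B (n + 1) j) =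
      1 / 4 * (ENNReal.ofReal (1 - p - q) ^ (n + 1) *
        ∫⁻ x in B, ENNReal.ofReal (1 / (2 * c)) * ENNReal.ofReal
          (flightDensity lam t (n + 1) ((t - (-1) ^ (j + (n + 1)) * x / c) / 2))) := by
  have hε : ((-1 : ℝ) ^ (j + (n + 1))) = 1 ∨ ((-1 : ℝ) ^ (j + (n + 1))) = -1 :=
    neg_one_pow_eq_or ℝ _
  have hcoord : ∀ i, Measurable fun v : ℕ → ℝ => v i := fun i => measurable_pi_apply i
  have hW : ∀ s : Finset ℕ, Measurable fun v : ℕ → ℝ => ∑ i ∈ s, v i := fun s => by fun_prop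
  have hdur := measurableSet_durations hB c t ((-1) ^ (j + (n + 1)))
  have hA : MeasurableSet {v : ℕ → ℝ |
      ∑ i ∈ offPhase (n + 1), v i ∈ durations c t ((-1) ^ (j + (n + 1))) B ∧
      ∑ i ∈ inPhase (n + 1), v i ≤ t - ∑ i ∈ offPhase (n + 1), v i ∧
        t - ∑ i ∈ offPhase (n + 1), v i < ∑ i ∈ inPhase (n + 1), v i + v (n + 1)} :=
    (hW _ hdur).inter ((measurableSet_le (hW _) (measurable_const.sub (hW _))).inter
      (measurableSet_lt (measurable_const.sub (hW _)) ((hW _).add (hcoord _))))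
  have hR : MeasurableSet {v : ℕ → ℤ | ∀ m < n + 1, v m = 2} := by
    simp only [ofPred_forall]
    exact MeasurableSet.iInter fun m => MeasurableSet.iInter fun _ =>
      measurable_pi_apply m (measurableSet_singleton 2)
  have h₁ := h.indep_init.measure_inter_preimage_eq_mul {(2 * j : ℤ)} _
    (measurableSet_singleton _) (hA.prod hR)
  have h₂ := h.indep_time_turn.measure_inter_preimage_eq_mul _ _ hA hR
  have hinit : P (J₀ ⁻¹' {(2 * j : ℤ)}) = 1 / 4 := h.law_init _ (by omega) (by omega)
  have hcard : (offPhase (n + 1)).card = n / 2 + 1 := by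
    rw [(card_inPhase_and_card_offPhase (n + 1)).2]
    omega
  have h₃ := measure_sum_mem_and_le_lt_add hlam h.indep_time h.measurable_time h.law_time
    hcard (disjoint_offPhase_inPhase _) (notMem_offPhase _) (notMem_inPhase _) hdur
    (durations_subset_Icc hc hε hBt)
  have hfd : ∀ w, lam ^ (n / 2 + 1 + (inPhase (n + 1)).card) * Real.exp (-lam * t) * w ^ (n / 2) /
      (n / 2).factorial * (t - w) ^ (inPhase (n + 1)).card / (inPhase (n + 1)).card.factorial =
      flightDensity lam t (n + 1) w := fun w => by
    have hn : n / 2 + 1 + (n + 1) / 2 = n + 1 := by omega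
    rw [(card_inPhase_and_card_offPhase (n + 1)).1, hn, flightDensity, Nat.add_sub_cancel]
  simp only [hfd] at h₃
  rw [lintegral_durations hc hε hB] at h₃
  have hset : alternatingEvent c J₀ τ ξ t B (n + 1) j = J₀ ⁻¹' {(2 * j : ℤ)} ∩
      (fun ω => ((fun n => τ n ω), (fun n => ξ n ω))) ⁻¹' ({v : ℕ → ℝ |
      ∑ i ∈ offPhase (n + 1), v i ∈ durations c t ((-1) ^ (j + (n + 1))) B ∧
      ∑ i ∈ inPhase (n + 1), v i ≤ t - ∑ i ∈ offPhase (n + 1), v i ∧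
        t - ∑ i ∈ offPhase (n + 1), v i < ∑ i ∈ inPhase (n + 1), v i + v (n + 1)} ×ˢ
        {v : ℕ → ℤ | ∀ m < n + 1, v m = 2}) := by
    ext ω
    simp only [alternatingEvent, mem_inter_iff, mem_ofPred_eq, mem_preimage, mem_singleton_iff,
      mem_prod]
    tauto
  rw [hset, h₁, hinit, ← h₃, mul_comm (ENNReal.ofReal _ ^ _), ← h.measure_reflections]
  congr 1

theorem IsDriving.measure_alternatingEvent_union (h : IsDriving P lam p q J₀ τ ξ)
    (hlam : 0 < lam) (hpq : p + q < 1) {c t : ℝ} (hc : 0 < c) {B : Set ℝ} (hB : MeasurableSet B)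
    (hBt : B ⊆ Ioo (-(c * t)) (c * t)) (n : ℕ) :
    P (alternatingEvent c J₀ τ ξ t B (n + 1) 0 ∪ alternatingEvent c J₀ τ ξ t B (n + 1) 1) =
      ∫⁻ x in B, ENNReal.ofReal (1 / 4 * (1 - p - q) ^ (n + 1) * (1 / (2 * c)) *
        (flightDensity lam t (n + 1) ((t + x / c) / 2) +
          flightDensity lam t (n + 1) ((t - x / c) / 2))) := by
  have hdisj : Disjoint (alternatingEvent c J₀ τ ξ t B (n + 1) 0)
      (alternatingEvent c J₀ τ ξ t B (n + 1) 1) := by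
    refine disjoint_left.2 fun ω h₀ h₁ => ?_
    have e₀ : J₀ ω = 2 * (0 : ℕ) := h₀.1
    have e₁ : J₀ ω = 2 * (1 : ℕ) := h₁.1
    omega
  have hmeas : ∀ ε : ℝ, Measurable fun x : ℝ =>
      ENNReal.ofReal (flightDensity lam t (n + 1) ((t - ε * x / c) / 2)) := fun ε => by
    unfold flightDensity
    fun_prop
  have hadd : ∀ ε ε' : ℝ, Measurable fun x : ℝ =>
      ENNReal.ofReal (1 / (2 * c)) *
          ENNReal.ofReal (flightDensity lam t (n + 1) ((t - ε * x / c) / 2)) +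
        ENNReal.ofReal (1 / (2 * c)) *
          ENNReal.ofReal (flightDensity lam t (n + 1) ((t - ε' * x / c) / 2)) :=
    fun ε ε' => ((hmeas ε).const_mul _).add ((hmeas ε').const_mul _)
  have hr : 0 < 1 - p - q := by linarith
  have hquarter : (1 / 4 : ENNReal) = ENNReal.ofReal (1 / 4) := by
    rw [ENNReal.ofReal_div_of_pos (by norm_num)]
    simp
  rw [measure_union hdisj (h.measurableSet_alternatingEvent c t hB _ _),
    h.measure_alternatingEvent hlam hc hB hBt n (by norm_num),
    h.measure_alternatingEvent hlam hc hB hBt n (by norm_num), ← mul_add, ← mul_add,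
    ← lintegral_add_left ((hmeas _).const_mul _), ← mul_assoc, ← lintegral_const_mul _ (hadd _ _)]
  refine setLIntegral_congr_fun hB fun x hx => ?_
  have hx' := hBt hx
  have hxc : |x / c| ≤ t := by
    rw [abs_div, abs_of_pos hc, div_le_iff₀ hc, mul_comm]
    exact (abs_lt.2 hx').le
  have hnonneg : ∀ ε : ℝ, ε = 1 ∨ ε = -1 →
      0 ≤ flightDensity lam t (n + 1) ((t - ε * x / c) / 2) := by
    intro ε hε
    have hb := abs_le.1 hxc
    have h₁ : 0 ≤ (t - ε * x / c) / 2 := by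
      rcases hε with rfl | rfl
      · rw [one_mul]; linarith
      · rw [neg_one_mul, neg_div]; linarith
    have h₂ : 0 ≤ t - (t - ε * x / c) / 2 := by
      rcases hε with rfl | rfl
      · rw [one_mul]; linarith
      · rw [neg_one_mul, neg_div]; linarith
    unfold flightDensity
    positivity
  have e₀ := hnonneg _ (neg_one_pow_eq_or ℝ (0 + (n + 1)))
  have e₁ := hnonneg _ (neg_one_pow_eq_or ℝ (1 + (n + 1)))
  rw [hquarter, ← ENNReal.ofReal_pow hr.le, ← mul_add, ← ENNReal.ofReal_add e₀ e₁,
    ← ENNReal.ofReal_mul (by positivity), ← ENNReal.ofReal_mul (by positivity),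
    ← ENNReal.ofReal_mul (by positivity), ← mul_assoc]
  congr 2
  -- The two initial directions always give opposite signs; the parity of `n` only decides the order
  -- of the two summands.
  rcases neg_one_pow_eq_or ℝ n with hn | hn <;>
  · simp only [pow_add, hn, pow_zero, pow_one, one_mul, mul_one, neg_mul, neg_neg, mul_neg, neg_div,
      sub_neg_eq_add]
    try rw [add_comm]

theorem IsDriving.ae_mem_iff (h : IsDriving P lam p q J₀ τ ξ) (hlam : 0 < lam) (hp : 0 ≤ p)
    (hq : 0 ≤ q) (hpq : p + q < 1) {c t : ℝ} (hc : 0 < c) (ht : 0 < t) {B : Set ℝ}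
    (hBt : B ⊆ Ioo (-(c * t)) (c * t)) :
    ∀ᵐ ω ∂P, (posX c J₀ τ ξ t ω ∈ B ∧ posY c J₀ τ ξ t ω = 0) ↔
      ω ∈ ⋃ n, (alternatingEvent c J₀ τ ξ t B (n + 1) 0 ∪
        alternatingEvent c J₀ τ ξ t B (n + 1) 1) := by
  filter_upwards [h.ae_time_pos, h.ae_ne_of_ne_zero t, h.ae_exists_arrival hlam ht.le,
    h.ae_init_mem, h.ae_turn_mem hp hq hpq] with ω hpos hgen hex hinit hturn
  simp only [mem_iUnion, mem_union, mem_alternatingEvent_iff hpos]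
  constructor
  · rintro ⟨hX, hY⟩
    obtain ⟨n, h₁, h₂⟩ := hex
    have heven := (posY_eq_zero_iff hc J₀ ξ hpos ht h₁ h₂ (hgen n)).1 hY
    have hξ : ∀ m < n, ξ m ω = 2 := by
      intro m hm
      have a₁ := heven m hm.le
      have a₂ := heven (m + 1) hm
      -- Consecutive even indices force an even turn, and among 1, -1, 2 only the reflection is
      -- even.
      rw [turnIndex, Finset.sum_range_succ, ← add_assoc, ← turnIndex, Int.even_add] at a₂
      have a₃ := a₂.1 a₁
      rcases hturn m with h | h | h
      · rw [h] at a₃; exact absurd a₃ (by decide)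
      · rw [h] at a₃; exact absurd a₃ (by decide)
      · exact h
    have hJ : ∃ j : ℕ, j < 2 ∧ J₀ ω = 2 * j := by
      have a₀ := heven 0 n.zero_le
      simp only [turnIndex, Finset.range_zero, Finset.sum_empty, add_zero] at a₀
      obtain ⟨k, hk⟩ := a₀
      exact ⟨k.toNat, by omega, by omega⟩
    obtain ⟨j, hj, hJ⟩ := hJ
    rcases n with _ | n
    -- Without turns the abscissa is `± c t`, excluded by the open interval.
    · have hX' := hBt hX
      rw [posX_eq c hpos h₁ h₂ hJ hξ] at hX'
      simp only [offPhase, Finset.range_zero, Finset.filter_empty, Finset.sum_empty, mul_zero,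
        sub_zero, mem_Ioo] at hX'
      rcases neg_one_pow_eq_or ℝ (j + 0) with e | e <;> rw [e] at hX' <;> exfalso <;>
        linarith [hX'.1, hX'.2]
    · refine ⟨n, ?_⟩
      interval_cases j
      · exact Or.inl ⟨hJ, hξ, hX, h₁, h₂⟩
      · exact Or.inr ⟨hJ, hξ, hX, h₁, h₂⟩
  · rintro ⟨n, hn⟩
    have hj : ∃ j : ℕ, J₀ ω = 2 * j ∧ (∀ m < n + 1, ξ m ω = 2) ∧ posX c J₀ τ ξ t ω ∈ B ∧
        arrival τ (n + 1) ω ≤ t ∧ t < arrival τ (n + 1 + 1) ω := hn.elim (⟨0, ·⟩) (⟨1, ·⟩)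
    obtain ⟨j, hJ, hξ, hX, h₁, h₂⟩ := hj
    refine ⟨hX, (posY_eq_zero_iff hc J₀ ξ hpos ht h₁ h₂ (hgen (n + 1))).2 fun m hm => ?_⟩
    rw [turnIndex, hJ, Finset.sum_congr rfl
      (fun k hk => hξ k ((Finset.mem_range.1 hk).trans_le hm))]
    exact ⟨j + m, by simp; ring⟩

theorem IsDriving.measure_posX_mem_posY_eq_zero (h : IsDriving P lam p q J₀ τ ξ) (hlam : 0 < lam)
    (hp : 0 ≤ p) (hq : 0 ≤ q) (hpq : p + q < 1) {c t : ℝ} (hc : 0 < c) (ht : 0 < t) {B : Set ℝ}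
    (hB : MeasurableSet B) (hBt : B ⊆ Ioo (-(c * t)) (c * t)) :
    P {ω | posX c J₀ τ ξ t ω ∈ B ∧ posY c J₀ τ ξ t ω = 0} =
      ∫⁻ x in B, ENNReal.ofReal (diagDensity lam c p q x t) := by
  have hset : {ω | posX c J₀ τ ξ t ω ∈ B ∧ posY c J₀ τ ξ t ω = 0} =ᵐ[P]
      ⋃ n, (alternatingEvent c J₀ τ ξ t B (n + 1) 0 ∪
        alternatingEvent c J₀ τ ξ t B (n + 1) 1) := by
    filter_upwards [h.ae_mem_iff hlam hp hq hpq hc ht hBt] with ω hω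
    exact propext hω
  have hdisj : Pairwise (Function.onFun (AEDisjoint P) fun n =>
      (alternatingEvent c J₀ τ ξ t B (n + 1) 0 ∪ alternatingEvent c J₀ τ ξ t B (n + 1) 1)) := by
    intro n m hnm
    have hnull : P {ω | ¬ ∀ i, 0 < τ i ω} = 0 := ae_iff.1 h.ae_time_pos
    refine measure_mono_null (fun ω hω => ?_) hnull
    intro hpos
    -- The number of turns up to `t` determines the index `k`, so different indices are incompatible
    -- once all times are positive.
    have hcount : ∀ k, ω ∈ alternatingEvent c J₀ τ ξ t B (k + 1) 0 ∪
        alternatingEvent c J₀ τ ξ t B (k + 1) 1 → count τ t ω = k + 1 := by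
      intro k hk
      simp only [mem_union, mem_alternatingEvent_iff hpos] at hk
      rcases hk with ⟨_, _, _, h₁, h₂⟩ | ⟨_, _, _, h₁, h₂⟩ <;> exact count_eq hpos h₁ h₂
    have := (hcount n hω.1).symm.trans (hcount m hω.2)
    omega
  have hmeas : ∀ n, MeasurableSet (alternatingEvent c J₀ τ ξ t B (n + 1) 0 ∪
      alternatingEvent c J₀ τ ξ t B (n + 1) 1) := fun n =>
    (h.measurableSet_alternatingEvent c t hB _ _).union
      (h.measurableSet_alternatingEvent c t hB _ _)
  rw [measure_congr hset, measure_iUnion₀ hdisj fun n => (hmeas n).nullMeasurableSet]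
  simp only [h.measure_alternatingEvent_union hlam hpq hc hB hBt]
  have hr : 0 < 1 - p - q := by linarith
  rw [← lintegral_tsum fun n => by
    unfold flightDensity
    fun_prop]
  refine setLIntegral_congr_fun hB fun x hx => ?_
  have hx' := abs_lt.2 (hBt hx)
  have hxc : |x / c| ≤ t := by
    rw [abs_div, abs_of_pos hc, div_le_iff₀ hc, mul_comm]
    exact hx'.le
  have hb := abs_le.1 hxc
  have hs := hasSum_diagDensity (lam := lam) (p := p) (q := q) hc hx'
  rw [← hs.tsum_eq, ENNReal.ofReal_tsum_of_nonneg (fun n => ?_) hs.summable]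
  have h₁ : 0 ≤ (t + x / c) / 2 := by linarith
  have h₂ : 0 ≤ (t - x / c) / 2 := by linarith
  have h₃ : 0 ≤ t - (t + x / c) / 2 := by linarith
  have h₄ : 0 ≤ t - (t - x / c) / 2 := by linarith
  unfold flightDensity
  positivity

end Alternating

end PlanarMotion

end

theorem mainTheorem6 {Ω : Type*} [MeasurableSpace Ω] (P : Measure Ω) [IsProbabilityMeasure P]
    (lam c p q : ℝ) (hlam : 0 < lam) (hc : 0 < c) (hp : 0 ≤ p) (hq : 0 ≤ q) (hpq : p + q < 1)
    (J₀ : Ω → ℤ) (τ : ℕ → Ω → ℝ) (ξ : ℕ → Ω → ℤ)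
    (hmotion : PlanarMotion.IsDriving P lam p q J₀ τ ξ)
    (t : ℝ) (ht : 0 < t) :
    (∀ x : ℝ, |x| < c * t →
      DifferentiableAt ℝ (fun s => PlanarMotion.besselTerm lam c p q x s) t ∧
      0 ≤ PlanarMotion.diagDensity lam c p q x t) ∧
    ContinuousOn (fun x => PlanarMotion.diagDensity lam c p q x t) (Ioo (-(c * t)) (c * t)) ∧
    ∀ B : Set ℝ, MeasurableSet B → B ⊆ Ioo (-(c * t)) (c * t) →
      P {ω | PlanarMotion.posX c J₀ τ ξ t ω ∈ B ∧ PlanarMotion.posY c J₀ τ ξ t ω = 0} =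
        ∫⁻ x in B, ENNReal.ofReal (PlanarMotion.diagDensity lam c p q x t) := by
  exact ⟨fun x hx => ⟨(PlanarMotion.hasDerivAt_besselTerm hc hx).differentiableAt,
      PlanarMotion.diagDensity_nonneg hlam hc ht hpq hx⟩,
    PlanarMotion.continuousOn_diagDensity hc, fun B hB hBt =>
      hmotion.measure_posX_mem_posY_eq_zero hlam hp hq hpq hc ht hB hBt⟩
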